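/- Let $P$ be a finite nonempty set of points in the Euclidean plane. For $p\in P$ let $C_0(p),\dots,C_3(p)$ be the four quadrants with apex $p$ bounded by the axis-parallel rays from $p$, in counter-clockwise order starting from the downward vertical ray. Assume that $P$ is in general position: no two points of $P$ lie on a line parallel to the boundary or to the angle bisector of one of these cones (that is, on a horizontal line, a vertical line, or a line of slope $\pm1$). The $\theta_4$-graph of $P$ has vertex set $P$; for every $p\in P$ and every $i$ for which $C_i(p)$ contains a point of $P\setminus\{p\}$, it has an edge between $p$ and the point of $(P\setminus\{p\})\cap C_i(p)$ whose orthogonal projection onto the angle bisector of $C_i(p)$ is closest to $p$. Edges are weighted by Euclidean length. For $t\ge 1$, a graph on $P$ is a $t$-spanner (of the complete Euclidean graph on $P$) if it is connected and, for all $u,v\in P$, its shortest path from $u$ to $v$ has length at most $t\,|uv|$; its stretch factor is the smallest such $t$. Then the $\theta_4$-graph of $P$ is a geometric spanner, namely a $t$-spanner for $$t=(1+\sqrt2)\,(\sqrt2+36)\,\sqrt{4+2\sqrt2}<237,$$ so its stretch factor is at most this constant. -/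

import Mathlib

open scoped NNReal ENNReal

/-! ## Weighted graphs, shortest paths and spanners -/

/-- The total weight of the edges of a walk. -/
def walkWeight {V : Type*} (w : V → V → ℝ≥0) {G : SimpleGraph V} {u v : V}
    (p : G.Walk u v) : ℝ≥0 :=
  (p.darts.map fun d => w d.fst d.snd).sum

/-- The weight of a shortest path from `u` to `v` in `G` (`∞` if there is no path). -/
noncomputable def shortestPathWeight {V : Type*} (w : V → V → ℝ≥0) (G : SimpleGraph V)
    (u v : V) : ℝ≥0∞ :=
  ⨅ p : G.Path u v, (walkWeight w (p : G.Walk u v) : ℝ≥0∞)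

/-- `H` is a `t`-spanner of the weighted graph `(G, w)`: a connected subgraph (on the same
vertices) in which shortest paths weigh at most `t` times as much as in `G`; here `1 ≤ t`. -/
structure IsSpanner {V : Type*} (w : V → V → ℝ≥0) (G H : SimpleGraph V) (t : ℝ) : Prop where
  one_le : 1 ≤ t
  le : H ≤ G
  connected : H.Connected
  weight_le : ∀ u v : V,
    shortestPathWeight w H u v ≤ ENNReal.ofReal t * shortestPathWeight w G u v

/-- `t` is the stretch factor of `H` in `(G, w)`: the smallest constant for which `H` is a
`t`-spanner. -/
def IsStretchFactor {V : Type*} (w : V → V → ℝ≥0) (G H : SimpleGraph V) (t : ℝ) : Prop :=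
  IsLeast {t : ℝ | IsSpanner w G H t} t

/-! ## The theta-graph with four cones -/

/-- The Euclidean plane. -/
abbrev Plane : Type := EuclideanSpace ℝ (Fin 2)

/-- The weight of an edge of a graph on a planar point set: the Euclidean distance. -/
noncomputable def euclideanWeight (P : Finset Plane) (u v : P) : ℝ≥0 :=
  nndist (u : Plane) (v : Plane)

/-- Directions of the four rays that bound the cones, in counter-clockwise order, starting
from the negative `y`-axis. -/
noncomputable def rayDir : Fin 4 → Plane :=
  ![!₂[0, -1], !₂[1, 0], !₂[0, 1], !₂[-1, 0]]

/-- The cone `C_i(p)` with apex `p` between the rays of directions `rayDir i` and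
`rayDir (i + 1)` (indices modulo 4). -/
def cone (i : Fin 4) (p : Plane) : Set Plane :=
  {q | ∃ a b : ℝ, 0 ≤ a ∧ 0 ≤ b ∧ q = p + (a • rayDir i + b • rayDir (i + 1))}

/-- The unit direction of the angle bisector of the cone `C_i(p)`. -/
noncomputable def bisectorDir (i : Fin 4) : Plane :=
  (√2)⁻¹ • (rayDir i + rayDir (i + 1))

/-- The orthogonal projection of `q` onto the angle bisector of `C_i(p)`. -/
noncomputable def bisectorProj (i : Fin 4) (p q : Plane) : Plane :=
  p + (inner ℝ (bisectorDir i) (q - p)) • bisectorDir i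

/-- `q` is the neighbour `p_i` of `p` in the cone `C_i(p)`: among the points of `P` in the cone
other than the apex, it is the one whose projection onto the bisector is closest to `p`. -/
def IsConeNeighbor (P : Finset Plane) (i : Fin 4) (p q : Plane) : Prop :=
  q ∈ P ∧ q ∈ cone i p ∧ q ≠ p ∧
    ∀ w ∈ P, w ∈ cone i p → w ≠ p → w ≠ q →
      dist p (bisectorProj i p q) < dist p (bisectorProj i p w)

/-- The theta-graph of `P` with four cones: `p` and `q` are joined if one of them is the
neighbour of the other in one of its cones. -/
def theta4Graph (P : Finset Plane) : SimpleGraph P :=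
  SimpleGraph.fromRel fun p q : P => ∃ i : Fin 4, IsConeNeighbor P i p q

/-- General position: no two points of `P` lie on a line parallel to the boundary or to the
angle bisector of a cone. -/
def GeneralPosition (P : Finset Plane) : Prop :=
  ∀ p ∈ P, ∀ q ∈ P, p ≠ q → ∀ i : Fin 4,
    q - p ∉ Submodule.span ℝ {rayDir i} ∧ q - p ∉ Submodule.span ℝ {bisectorDir i}

/-!
Fix a target `t` and coordinates `(A, B)` centred at `t`. An edge of the graph leads to an
`L¹`-nearest vertex of a quadrant, so a step into a quadrant that contains `x` remains on the near
side of the antidiagonal of `x`. Steps up and to the left that aim at a vertex `x` on or below the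
diagonal `A = B` therefore stay below it, and a walk of such steps is as long as its displacement.

Let `u` be a vertex of the positive quadrant from which one cannot climb any further within its
octant. Take the edge to its neighbour `n` towards `t`, with `B n < A n` say, and climb from `n` up
and to the left as far as possible. The climb ends at `t`, in the octant `0 < B < A`, or in the
octant `B < A < 0`. Since `n` is `L¹`-nearest to `u`, no vertex below and to the left of `u` is
beyond the antidiagonal of `n`. In the first two cases this pays for the walk by the decrease of the
sup norm and of the `L¹` norm. In the third case `-B n` may be comparable with the norm of `u`, but
the octant of `u` now contains no vertex with norm between `A n + B n` and the norm of the end of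
the climb. So the largest norm of a vertex of that octant that is still ahead drops by at least
`-B n`, and this pays for the crossing.
-/

section Walks

variable {V : Type*} {w : V → V → ℝ≥0} {G : SimpleGraph V} {p q r : V} {a b : ℝ}

/-- There is a walk from `p` to `q` of weight at most `ℓ`. The bound is a real number, so that walk
lengths can be estimated by differences of coordinates. -/
def ReachesWithin (w : V → V → ℝ≥0) (G : SimpleGraph V) (p q : V) (ℓ : ℝ) : Prop :=
  ∃ W : G.Walk p q, (walkWeight w W : ℝ) ≤ ℓ

theorem walkWeight_append (W : G.Walk p q) (W' : G.Walk q r) :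
    walkWeight w (W.append W') = walkWeight w W + walkWeight w W' := by
  simp [walkWeight, SimpleGraph.Walk.darts_append]

theorem walkWeight_toPath_le [DecidableEq V] (W : G.Walk p q) :
    walkWeight w (W.toPath : G.Walk p q) ≤ walkWeight w W :=
  (W.darts_bypass_sublist_darts.map _).sum_le_sum fun _ _ => zero_le

theorem le_walkWeight (hself : ∀ u, w u u = 0) (htri : ∀ u v x, w u x ≤ w u v + w v x)
    (W : G.Walk p q) : w p q ≤ walkWeight w W := by
  induction W with
  | nil => simp [hself]
  | @cons u v x _ W ih =>
    refine (htri u v x).trans ?_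
    simpa [walkWeight] using ih

namespace ReachesWithin

theorem refl (p : V) : ReachesWithin w G p p 0 := ⟨.nil, by simp [walkWeight]⟩

theorem of_adj (h : G.Adj p q) : ReachesWithin w G p q (w p q) :=
  ⟨h.toWalk, by simp [walkWeight, SimpleGraph.Adj.toWalk]⟩

theorem mono (h : ReachesWithin w G p q a) (hab : a ≤ b) : ReachesWithin w G p q b :=
  h.imp fun _ hW => hW.trans hab

theorem trans (h : ReachesWithin w G p q a) (h' : ReachesWithin w G q r b) :
    ReachesWithin w G p r (a + b) := by
  obtain ⟨W, hW⟩ := h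
  obtain ⟨W', hW'⟩ := h'
  refine ⟨W.append W', ?_⟩
  rw [walkWeight_append, NNReal.coe_add]
  exact add_le_add hW hW'

theorem shortestPathWeight_le (h : ReachesWithin w G p q a) :
    shortestPathWeight w G p q ≤ ENNReal.ofReal a := by
  classical
  obtain ⟨W, hW⟩ := h
  refine (iInf_le _ W.toPath).trans ?_
  rw [← ENNReal.ofReal_coe_nnreal]
  exact ENNReal.ofReal_le_ofReal ((NNReal.coe_le_coe.mpr (walkWeight_toPath_le W)).trans hW)

end ReachesWithin

end Walks

section Spanners

variable {V : Type*} {w : V → V → ℝ≥0} {G H : SimpleGraph V} {c s : ℝ}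

theorem le_shortestPathWeight (hself : ∀ u, w u u = 0) (htri : ∀ u v x, w u x ≤ w u v + w v x)
    (u v : V) : (w u v : ℝ≥0∞) ≤ shortestPathWeight w G u v :=
  le_iInf fun p => ENNReal.coe_le_coe.mpr (le_walkWeight hself htri (p : G.Walk u v))

theorem shortestPathWeight_ne_top (hG : G.Connected) (u v : V) :
    shortestPathWeight w G u v ≠ ∞ := by
  obtain ⟨W⟩ := hG u v
  exact ne_top_of_le_ne_top ENNReal.ofReal_ne_top
    (ReachesWithin.shortestPathWeight_le (w := w) ⟨W, le_rfl⟩)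

theorem IsSpanner.mono (h : IsSpanner w G H c) (hcs : c ≤ s) : IsSpanner w G H s where
  one_le := h.one_le.trans hcs
  le := h.le
  connected := h.connected
  weight_le u v := (h.weight_le u v).trans (mul_le_mul_left (ENNReal.ofReal_le_ofReal hcs) _)

theorem IsSpanner.of_reachesWithin [Nonempty V] (hself : ∀ u, w u u = 0)
    (htri : ∀ u v x, w u x ≤ w u v + w v x) (hc : 1 ≤ c)
    (h : ∀ u v, ReachesWithin w H u v (c * w u v)) : IsSpanner w ⊤ H c where
  one_le := hc
  le := le_top
  connected := { preconnected := fun u v => (h u v).nonempty }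
  weight_le u v := calc
    shortestPathWeight w H u v ≤ ENNReal.ofReal (c * w u v) := (h u v).shortestPathWeight_le
    _ = ENNReal.ofReal c * w u v := by
      rw [ENNReal.ofReal_mul (zero_le_one.trans hc), ENNReal.ofReal_coe_nnreal]
    _ ≤ ENNReal.ofReal c * shortestPathWeight w ⊤ u v := by
      gcongr
      exact le_shortestPathWeight hself htri u v

theorem isClosed_setOf_isSpanner (hG : G.Connected) : IsClosed {s : ℝ | IsSpanner w G H s} := by
  by_cases hH : H ≤ G ∧ H.Connected
  · have hset : {s : ℝ | IsSpanner w G H s} = Set.Ici 1 ∩ ⋂ u : V, ⋂ v : V,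
        {s : ℝ | shortestPathWeight w H u v ≤ ENNReal.ofReal s * shortestPathWeight w G u v} := by
      ext s
      simp only [Set.mem_ofPred_eq, Set.mem_inter_iff, Set.mem_iInter, Set.mem_Ici]
      exact ⟨fun h => ⟨h.one_le, h.weight_le⟩, fun h => ⟨h.1, hH.1, hH.2, h.2⟩⟩
    rw [hset]
    refine isClosed_Ici.inter <| isClosed_iInter fun u => isClosed_iInter fun v =>
      isClosed_le continuous_const ?_
    exact (ENNReal.continuous_mul_const (shortestPathWeight_ne_top hG u v)).comp
      ENNReal.continuous_ofReal
  · convert isClosed_empty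
    exact Set.eq_empty_of_forall_notMem fun s h => hH ⟨h.le, h.connected⟩

theorem IsSpanner.exists_isStretchFactor (hG : G.Connected) (h : IsSpanner w G H s) :
    ∃ τ, IsStretchFactor w G H τ ∧ τ ≤ s :=
  have hbdd : BddBelow {s : ℝ | IsSpanner w G H s} := ⟨1, fun _ hs => hs.one_le⟩
  ⟨_, (isClosed_setOf_isSpanner hG).isLeast_csInf ⟨s, h⟩ hbdd, csInf_le hbdd h⟩

end Spanners

section Potential

variable {V : Type*} {A B : V → ℝ} {u x : V} {c m m' : ℝ}

/-- The sup norm of the coordinates of a vertex. -/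
noncomputable def supNorm (A B : V → ℝ) (x : V) : ℝ := ‖(A x, B x)‖

theorem supNorm_swap (A B : V → ℝ) : supNorm B A = supNorm A B :=
  funext fun _ => max_comm _ _

theorem supNorm_neg (A B : V → ℝ) : supNorm (-A) (-B) = supNorm A B :=
  funext fun x => norm_neg (A x, B x)

theorem supNorm_nonneg (A B : V → ℝ) (x : V) : 0 ≤ supNorm A B x := norm_nonneg _

theorem fst_le_supNorm (A B : V → ℝ) (x : V) : A x ≤ supNorm A B x :=
  (Real.le_norm_self _).trans (norm_fst_le (A x, B x))

theorem supNorm_eq_fst (hB : 0 < B x) (hBA : B x < A x) : supNorm A B x = A x := by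
  rw [supNorm, Prod.norm_mk, Real.norm_of_nonneg hB.le, Real.norm_of_nonneg (hB.trans hBA).le,
    max_eq_left hBA.le]

theorem supNorm_eq_snd (hA : 0 < A x) (hAB : A x < B x) : supNorm A B x = B x := by
  rw [← supNorm_swap, supNorm_eq_fst hA hAB]

/-- The largest sup norm, among those that are at most `m`, of a vertex of the octant `0 < B < A`;
it is `0` if there is no such vertex. On this octant the sup norm is the coordinate `A`. The other
octants are obtained by exchanging and negating the coordinates. -/
noncomputable def octantRadius (A B : V → ℝ) (m : ℝ) : ℝ :=
  sSup (A '' {x | 0 < B x ∧ B x < A x ∧ A x ≤ m})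

theorem octantRadius_nonneg (A B : V → ℝ) (m : ℝ) : 0 ≤ octantRadius A B m :=
  Real.sSup_nonneg (Set.forall_mem_image.mpr fun _ hx => (hx.1.trans hx.2.1).le)

theorem octantRadius_le (hc : 0 ≤ c) (h : ∀ x, 0 < B x → B x < A x → A x ≤ m → A x ≤ c) :
    octantRadius A B m ≤ c :=
  Real.sSup_le (Set.forall_mem_image.mpr fun x hx => h x hx.1 hx.2.1 hx.2.2) hc

theorem le_octantRadius (hB : 0 < B x) (hBA : B x < A x) (hm : A x ≤ m) :
    A x ≤ octantRadius A B m :=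
  le_csSup ⟨m, Set.forall_mem_image.mpr fun _ hy => hy.2.2⟩ ⟨x, ⟨hB, hBA, hm⟩, rfl⟩

theorem octantRadius_mono (A B : V → ℝ) : Monotone (octantRadius A B) := fun _ _ h =>
  octantRadius_le (octantRadius_nonneg _ _ _) fun _ hB hBA hx =>
    le_octantRadius hB hBA (hx.trans h)

/-- The sum of the octant radii of the positive and the negative quadrant. -/
noncomputable def radiusSum (A B : V → ℝ) (m : ℝ) : ℝ :=
  octantRadius A B m + octantRadius B A m + octantRadius (-A) (-B) m + octantRadius (-B) (-A) m

theorem radiusSum_swap (A B : V → ℝ) : radiusSum B A = radiusSum A B := by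
  ext m
  simp only [radiusSum]
  ring

theorem radiusSum_neg (A B : V → ℝ) : radiusSum (-A) (-B) = radiusSum A B := by
  ext m
  simp only [radiusSum, neg_neg]
  ring

theorem radiusSum_nonneg (A B : V → ℝ) (m : ℝ) : 0 ≤ radiusSum A B m := by
  have hnonneg (A B : V → ℝ) := octantRadius_nonneg A B m
  exact add_nonneg (add_nonneg (add_nonneg (hnonneg _ _) (hnonneg _ _)) (hnonneg _ _))
    (hnonneg _ _)

theorem radiusSum_mono (A B : V → ℝ) : Monotone (radiusSum A B) :=
  (((octantRadius_mono _ _).add (octantRadius_mono _ _)).add (octantRadius_mono _ _)).add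
    (octantRadius_mono _ _)

theorem radiusSum_le (A B : V → ℝ) (hm : 0 ≤ m) : radiusSum A B m ≤ 4 * m := by
  have hle (A B : V → ℝ) : octantRadius A B m ≤ m := octantRadius_le hm fun _ _ _ h => h
  linarith [hle A B, hle B A, hle (-A) (-B), hle (-B) (-A), radiusSum.eq_def A B m]

theorem radiusSum_add_le (hB : 0 < B u) (hBA : B u < A u) (hm : m ≤ A u) (hc : 0 ≤ c)
    (h : ∀ x, 0 < B x → B x < A x → A x ≤ m → A x ≤ c) :
    radiusSum A B m + (A u - c) ≤ radiusSum A B (A u) := by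
  have hnew := octantRadius_le hc h
  have hold := le_octantRadius hB hBA le_rfl
  simp only [radiusSum]
  linarith [octantRadius_mono B A hm, octantRadius_mono (-A) (-B) hm,
    octantRadius_mono (-B) (-A) hm]

/-- The bound on the length of the route from a vertex of the positive quadrant to the origin. -/
noncomputable def routePotential (A B : V → ℝ) (x : V) : ℝ :=
  2 * supNorm A B x + A x + B x + 4 * radiusSum A B (supNorm A B x)

theorem routePotential_swap (A B : V → ℝ) : routePotential B A = routePotential A B := by
  ext x
  simp only [routePotential, supNorm_swap, radiusSum_swap A B]
  ring

end Potential

section Frames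

variable {V : Type*} {w : V → V → ℝ≥0} {G : SimpleGraph V} {t : V} {A B : V → ℝ}

/-- Whenever the open quadrant of `p` in which both coordinates `A` and `B` increase contains a
vertex, one can go from `p` to an `L¹`-nearest vertex of that quadrant at `L¹` cost. -/
def QuadrantStep (w : V → V → ℝ≥0) (G : SimpleGraph V) (A B : V → ℝ) : Prop :=
  ∀ p q, A p < A q → B p < B q → ∃ n, A p < A n ∧ B p < B n ∧
    (∀ x, A p < A x → B p < B x → A n + B n ≤ A x + B x) ∧
    ReachesWithin w G p n (A n - A p + (B n - B p))

theorem QuadrantStep.swap (h : QuadrantStep w G A B) : QuadrantStep w G B A := by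
  intro p q hB hA
  obtain ⟨n, hnA, hnB, hmin, hreach⟩ := h p q hA hB
  refine ⟨n, hnB, hnA, fun x hxB hxA => ?_, hreach.mono (add_comm _ _).le⟩
  rw [add_comm (B n), add_comm (B x)]
  exact hmin x hxA hxB

/-- Coordinates centred at the target `t`, in general position, that allow quadrant steps in all
four directions. -/
structure IsFrame (w : V → V → ℝ≥0) (G : SimpleGraph V) (t : V) (A B : V → ℝ) : Prop where
  step_pos_pos : QuadrantStep w G A B
  step_neg_pos : QuadrantStep w G (-A) B
  step_pos_neg : QuadrantStep w G A (-B)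
  step_neg_neg : QuadrantStep w G (-A) (-B)
  fst_target : A t = 0
  snd_target : B t = 0
  fst_injective : Function.Injective A
  snd_injective : Function.Injective B
  abs_fst_ne_abs_snd : ∀ p, p ≠ t → |A p| ≠ |B p|

/-- One can walk from `p` to `q`, which lies up and to the left of `p` in the weak sense, within the
`L¹` distance. -/
structure ClimbsTo (w : V → V → ℝ≥0) (G : SimpleGraph V) (A B : V → ℝ) (p q : V) : Prop where
  fst_le : A q ≤ A p
  le_snd : B p ≤ B q
  reachesWithin : ReachesWithin w G p q (A p - A q + (B q - B p))

namespace ClimbsTo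

variable {p q r : V}

theorem refl (p : V) : ClimbsTo w G A B p p :=
  ⟨le_rfl, le_rfl, (ReachesWithin.refl p).mono (by simp)⟩

theorem trans (h : ClimbsTo w G A B p q) (h' : ClimbsTo w G A B q r) : ClimbsTo w G A B p r where
  fst_le := h'.fst_le.trans h.fst_le
  le_snd := h.le_snd.trans h'.le_snd
  reachesWithin := (h.reachesWithin.trans h'.reachesWithin).mono (by linarith)

theorem neg_swap (h : ClimbsTo w G A B p q) : ClimbsTo w G (-B) (-A) p q where
  fst_le := neg_le_neg h.le_snd
  le_snd := neg_le_neg h.fst_le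
  reachesWithin := h.reachesWithin.mono (by simp only [Pi.neg_apply]; linarith)

end ClimbsTo

/-- The vertex `u` lies in the positive quadrant, and each vertex of this quadrant whose larger
coordinate is less than that of `u` is less than `u` in the other coordinate, too. For `u` in the
octant `0 < B < A` this says that no vertex of the octant is up and to the left of `u`. -/
structure IsSwept (A B : V → ℝ) (u : V) : Prop where
  fst_pos : 0 < A u
  snd_pos : 0 < B u
  snd_lt : ∀ x, 0 < B x → B x < A x → A x < A u → B x < B u
  fst_lt : ∀ x, 0 < A x → A x < B x → B x < B u → A x < A u

theorem IsSwept.swap {u : V} (h : IsSwept A B u) : IsSwept B A u :=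
  ⟨h.snd_pos, h.fst_pos, h.fst_lt, h.snd_lt⟩

/-- From the swept vertex `u` one reaches the target at the cost of the potential of `u`, or a swept
vertex of smaller sup norm at the cost of the decrease of the potential. The latter vertex may be
swept with respect to a different frame (in the proof: the opposite one), but the sup norms have to
agree so that descents can be iterated. -/
def Descends (w : V → V → ℝ≥0) (G : SimpleGraph V) (t : V) (A B : V → ℝ) (u : V) : Prop :=
  ReachesWithin w G u t (routePotential A B u) ∨
    ∃ A' B' s, IsFrame w G t A' B' ∧ supNorm A' B' = supNorm A B ∧ IsSwept A' B' s ∧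
      supNorm A B s < supNorm A B u ∧
      ReachesWithin w G u s (routePotential A B u - routePotential A' B' s)

theorem Descends.swap {u : V} (h : Descends w G t A B u) : Descends w G t B A u := by
  simpa only [Descends, supNorm_swap A B, routePotential_swap A B] using h

theorem wellFounded_lt_on_of_finite [Finite V] (f : V → ℝ) :
    WellFounded (Function.onFun (· < ·) f) :=
  Set.wellFoundedOn_range.mp (Set.finite_range f).wellFoundedOn

namespace IsFrame

theorem swap (h : IsFrame w G t A B) : IsFrame w G t B A where
  step_pos_pos := h.step_pos_pos.swap
  step_neg_pos := h.step_pos_neg.swap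
  step_pos_neg := h.step_neg_pos.swap
  step_neg_neg := h.step_neg_neg.swap
  fst_target := h.snd_target
  snd_target := h.fst_target
  fst_injective := h.snd_injective
  snd_injective := h.fst_injective
  abs_fst_ne_abs_snd p hp := (h.abs_fst_ne_abs_snd p hp).symm

theorem neg_fst (h : IsFrame w G t A B) : IsFrame w G t (-A) B where
  step_pos_pos := h.step_neg_pos
  step_neg_pos := by simpa only [neg_neg] using h.step_pos_pos
  step_pos_neg := h.step_neg_neg
  step_neg_neg := by simpa only [neg_neg] using h.step_pos_neg
  fst_target := by simp [h.fst_target]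
  snd_target := h.snd_target
  fst_injective := neg_injective.comp h.fst_injective
  snd_injective := h.snd_injective
  abs_fst_ne_abs_snd p hp := by simpa using h.abs_fst_ne_abs_snd p hp

theorem neg_snd (h : IsFrame w G t A B) : IsFrame w G t A (-B) := h.swap.neg_fst.swap

theorem neg (h : IsFrame w G t A B) : IsFrame w G t (-A) (-B) := h.neg_fst.neg_snd

variable {p u x : V}

theorem ne_target_of_fst_ne_zero (h : IsFrame w G t A B) (hp : A p ≠ 0) : p ≠ t := by
  rintro rfl
  exact hp h.fst_target

theorem fst_ne_zero (h : IsFrame w G t A B) (hp : p ≠ t) : A p ≠ 0 :=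
  h.fst_target ▸ h.fst_injective.ne hp

theorem snd_ne_zero (h : IsFrame w G t A B) (hp : p ≠ t) : B p ≠ 0 := h.swap.fst_ne_zero hp

theorem fst_ne_snd (h : IsFrame w G t A B) (hp : p ≠ t) : A p ≠ B p := fun he =>
  h.abs_fst_ne_abs_snd p hp (congrArg abs he)

theorem fst_add_snd_ne_zero (h : IsFrame w G t A B) (hp : p ≠ t) : A p + B p ≠ 0 := fun he =>
  h.abs_fst_ne_abs_snd p hp (abs_eq_abs.mpr (.inr (eq_neg_of_add_eq_zero_left he)))

theorem exists_climbsTo (h : IsFrame w G t A B) (hA : A x < A p) (hB : B p < B x) :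
    ∃ n, A n < A p ∧ B p < B n ∧ B n - A n ≤ B x - A x ∧ ClimbsTo w G A B p n := by
  obtain ⟨n, hnA, hnB, hmin, hreach⟩ := h.step_neg_pos p x (neg_lt_neg hA) hB
  have hnx := hmin x (neg_lt_neg hA) hB
  simp only [Pi.neg_apply, neg_lt_neg_iff] at hnA hnx hreach
  exact ⟨n, hnA, hnB, by linarith, hnA.le, hnB.le, hreach.mono (by linarith)⟩

theorem exists_step_toward_target (h : IsFrame w G t A B) (hA : 0 < A u) (hB : 0 < B u) :
    ∃ n, A n < A u ∧ B n < B u ∧ (∀ x, A x < A u → B x < B u → A x + B x ≤ A n + B n) ∧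
      ReachesWithin w G u n (A u - A n + (B u - B n)) := by
  obtain ⟨n, hnA, hnB, hmin, hreach⟩ := h.step_neg_neg u t (by simpa [h.fst_target] using hA)
    (by simpa [h.snd_target] using hB)
  simp only [Pi.neg_apply, neg_lt_neg_iff] at hnA hnB hmin hreach
  exact ⟨n, hnA, hnB, fun x hxA hxB => by linarith [hmin x hxA hxB], hreach.mono (by linarith)⟩

theorem radiusSum_add_sub_le (h : IsFrame w G t A B) (hu : IsSwept A B u) {c m : ℝ} (hc : 0 ≤ c)
    (hm : m < A u) (hmin : ∀ x, A x < A u → B x < B u → A x + B x ≤ c) :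
    radiusSum A B m + (A u - c) ≤ radiusSum A B (supNorm A B u) := by
  rcases (h.fst_ne_snd (h.ne_target_of_fst_ne_zero hu.fst_pos.ne')).lt_or_gt with hAB | hBA
  · have hdrop := radiusSum_add_le hu.fst_pos hAB (hm.trans hAB).le hc fun x hxA hxAB hxm => by
      linarith [hmin x (hxAB.trans_le hxm |>.trans hm) ((hxm.trans_lt hm).trans hAB)]
    rw [radiusSum_swap] at hdrop
    rw [supNorm_eq_snd hu.fst_pos hAB]
    linarith
  · rw [supNorm_eq_fst hu.snd_pos hBA]
    refine radiusSum_add_le hu.snd_pos hBA hm.le hc fun x hxB hxBA hxm => ?_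
    have hxA := hxm.trans_lt hm
    linarith [hmin x hxA (hu.snd_lt x hxB hxBA hxA)]

variable [Finite V]

theorem exists_isSwept (h : IsFrame w G t A B) (hB : 0 < B p) (hBA : B p < A p) :
    ∃ s, ClimbsTo w G A B p s ∧ B s < A s ∧ IsSwept A B s := by
  induction p using (wellFounded_lt_on_of_finite A).induction with
  | _ p ih =>
    by_cases hx : ∃ x, B x < A x ∧ A x < A p ∧ B p < B x
    · obtain ⟨x, hxBA, hxA, hxB⟩ := hx
      obtain ⟨n, hnA, hnB, hnx, hpn⟩ := h.exists_climbsTo hxA hxB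
      obtain ⟨s, hns, hs⟩ := ih n hnA (hB.trans hnB) (by linarith)
      exact ⟨s, hpn.trans hns, hs⟩
    · push Not at hx
      refine ⟨p, .refl p, hBA, hB.trans hBA, hB, fun x _ hxBA hxA => ?_, fun x _ hxAB hxB => ?_⟩
      · exact (hx x hxBA hxA).lt_of_ne (h.snd_injective.ne (ne_of_apply_ne A hxA.ne))
      · exact (hxAB.trans hxB).trans hBA

theorem exists_climbsTo_octant (h : IsFrame w G t A B) (hA : 0 < A p) (hBA : B p < A p) :
    ∃ z, ClimbsTo w G A B p z ∧ (z = t ∨ 0 < B z ∧ B z < A z ∨ B z < A z ∧ A z < 0) := by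
  induction p using (wellFounded_lt_on_of_finite A).induction with
  | _ p ih =>
    have hpt := h.ne_target_of_fst_ne_zero hA.ne'
    rcases (h.snd_ne_zero hpt).lt_or_gt with hB | hB
    · obtain ⟨n, hnA, -, hnt, hpn⟩ := h.exists_climbsTo (p := p) (x := t)
        (by rwa [h.fst_target]) (by rwa [h.snd_target])
      rw [h.fst_target, h.snd_target] at hnt
      rcases eq_or_ne n t with rfl | hne
      · exact ⟨n, hpn, .inl rfl⟩
      have hnBA : B n < A n := lt_of_le_of_ne (by linarith) (h.fst_ne_snd hne).symm
      rcases (h.fst_ne_zero hne).lt_or_gt with hnA0 | hnA0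
      · exact ⟨n, hpn, .inr (.inr ⟨hnBA, hnA0⟩)⟩
      · obtain ⟨z, hnz, hz⟩ := ih n hnA hnA0 hnBA
        exact ⟨z, hpn.trans hnz, hz⟩
    · exact ⟨p, .refl p, .inr (.inl ⟨hB, hBA⟩)⟩

theorem exists_climbsTo_isSwept (h : IsFrame w G t A B) (hA : 0 < A p) (hBA : B p < A p) :
    ∃ s, ClimbsTo w G A B p s ∧
      (s = t ∨ B s < A s ∧ IsSwept A B s ∨ B s < A s ∧ IsSwept (-A) (-B) s) := by
  obtain ⟨z, hpz, rfl | ⟨hzB, hzBA⟩ | ⟨hzBA, hzA⟩⟩ := h.exists_climbsTo_octant hA hBA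
  · exact ⟨z, hpz, .inl rfl⟩
  · obtain ⟨s, hzs, hs⟩ := h.exists_isSwept hzB hzBA
    exact ⟨s, hpz.trans hzs, .inr (.inl hs)⟩
  · obtain ⟨s, hzs, hsBA, hs⟩ := h.neg.swap.exists_isSwept (neg_pos.mpr hzA) (neg_lt_neg hzBA)
    have hzs' : ClimbsTo w G A B z s := by simpa only [neg_neg] using hzs.neg_swap
    exact ⟨s, hpz.trans hzs', .inr (.inr ⟨neg_lt_neg_iff.mp hsBA, hs.swap⟩)⟩

theorem descends_of_snd_lt_fst (h : IsFrame w G t A B) (hu : IsSwept A B u) {n : V}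
    (hnA : A n < A u) (hn : 0 < A n + B n) (hnBA : B n < A n)
    (hmin : ∀ x, A x < A u → B x < B u → A x + B x ≤ A n + B n)
    (hun : ReachesWithin w G u n (A u - A n + (B u - B n))) : Descends w G t A B u := by
  have huA := fst_le_supNorm A B u
  obtain ⟨s, hns, hs⟩ := h.exists_climbsTo_isSwept (by linarith) hnBA
  have hsA := hns.fst_le
  have hsB := hns.le_snd
  have hus := hun.trans hns.reachesWithin
  rcases hs with rfl | ⟨hsBA, hs⟩ | ⟨hsBA, hs⟩
  · refine .inl (hus.mono ?_)
    rw [h.fst_target, h.snd_target, routePotential]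
    linarith [radiusSum_nonneg A B (supNorm A B u)]
  · have hsn := hmin s (by linarith) (hu.snd_lt s hs.snd_pos hsBA (by linarith))
    have hnorm : supNorm A B s = A s := supNorm_eq_fst hs.snd_pos hsBA
    have hrad := radiusSum_mono A B (show supNorm A B s ≤ supNorm A B u by linarith)
    refine .inr ⟨A, B, s, h, rfl, hs, by linarith, hus.mono ?_⟩
    rw [routePotential, routePotential]
    linarith
  · have hnorm : supNorm A B s = -B s := by
      rw [← supNorm_neg, supNorm_eq_snd hs.fst_pos (neg_lt_neg hsBA), Pi.neg_apply]
    have hrad := h.radiusSum_add_sub_le hu hn.le (m := supNorm A B s) (by linarith) hmin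
    refine .inr ⟨-A, -B, s, h.neg, supNorm_neg A B, hs, by linarith, hus.mono ?_⟩
    simp only [routePotential, supNorm_neg, radiusSum_neg, Pi.neg_apply]
    linarith

theorem descends (h : IsFrame w G t A B) (hu : IsSwept A B u) : Descends w G t A B u := by
  obtain ⟨n, hnA, hnB, hmin, hun⟩ := h.exists_step_toward_target hu.fst_pos hu.snd_pos
  rcases eq_or_ne n t with rfl | hnt
  · refine .inl (hun.mono ?_)
    rw [h.fst_target, h.snd_target, routePotential]
    linarith [supNorm_nonneg A B u, radiusSum_nonneg A B (supNorm A B u)]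
  have ht := hmin t (h.fst_target ▸ hu.fst_pos) (h.snd_target ▸ hu.snd_pos)
  rw [h.fst_target, h.snd_target, add_zero] at ht
  have hn : 0 < A n + B n := ht.lt_of_ne (h.fst_add_snd_ne_zero hnt).symm
  rcases (h.fst_ne_snd hnt).lt_or_gt with hAB | hBA
  · simp only [add_comm (A _) (B _)] at hmin hn
    exact (h.swap.descends_of_snd_lt_fst hu.swap hnB hn hAB (fun x hxB hxA => hmin x hxA hxB)
      (hun.mono (add_comm _ _).le)).swap
  · exact h.descends_of_snd_lt_fst hu hnA hn hBA hmin hun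

theorem reachesWithin_routePotential (h : IsFrame w G t A B) (hu : IsSwept A B u) :
    ReachesWithin w G u t (routePotential A B u) := by
  obtain ⟨N, hN⟩ : ∃ N, supNorm A B = N := ⟨_, rfl⟩
  induction u using (wellFounded_lt_on_of_finite N).induction generalizing A B with
  | _ u ih =>
    rcases h.descends hu with hut | ⟨A', B', s, h', hnorm, hs, hlt, hus⟩
    · exact hut
    · exact (hus.trans (ih s (hN ▸ hlt) h' hs (hnorm.trans hN))).mono (by linarith)

/-- The constant is `1 + 20`: climbing from `p` to a swept vertex costs at most the sup norm of `p`,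
and the potential of a vertex of sup norm `c` is at most `2 * c + 2 * c + 4 * (4 * c)`. -/
theorem reachesWithin_supNorm (h : IsFrame w G t A B) (p : V) :
    ReachesWithin w G p t (21 * supNorm A B p) := by
  rcases eq_or_ne p t with rfl | hp
  · exact (ReachesWithin.refl p).mono (mul_nonneg (by norm_num) (supNorm_nonneg A B p))
  wlog hA : 0 < A p generalizing A B
  · have hA' : 0 < (-A) p := neg_pos.mpr ((h.fst_ne_zero hp).lt_of_le (not_lt.mp hA))
    simpa [supNorm] using this h.neg_fst hA'
  wlog hB : 0 < B p generalizing A B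
  · have hB' : 0 < (-B) p := neg_pos.mpr ((h.snd_ne_zero hp).lt_of_le (not_lt.mp hB))
    simpa [supNorm] using this h.neg_snd hA hB'
  wlog hBA : B p < A p generalizing A B
  · rw [← supNorm_swap]
    exact this h.swap hB hA ((h.fst_ne_snd hp).lt_of_le (not_lt.mp hBA))
  obtain ⟨s, hps, hsBA, hs⟩ := h.exists_isSwept hB hBA
  refine (hps.reachesWithin.trans (h.reachesWithin_routePotential hs)).mono ?_
  rw [routePotential, supNorm_eq_fst hs.snd_pos hsBA, supNorm_eq_fst hB hBA]
  linarith [radiusSum_le A B hs.fst_pos.le, hps.fst_le]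

end IsFrame

end Frames

section Cones

open scoped InnerProductSpace

theorem norm_rayDir (i : Fin 4) : ‖rayDir i‖ = 1 := by
  fin_cases i <;> simp [rayDir, EuclideanSpace.norm_eq]

theorem inner_rayDir_add_one (i : Fin 4) : ⟪rayDir i, rayDir (i + 1)⟫_ℝ = 0 := by
  fin_cases i <;> simp [rayDir, PiLp.inner_apply]

theorem rayDir_add_two (i : Fin 4) : rayDir (i + 2) = -rayDir i := by
  ext j
  fin_cases i <;> fin_cases j <;> simp [rayDir]

theorem inner_smul_rayDir_add (i : Fin 4) (v : Plane) :
    ⟪rayDir i, v⟫_ℝ • rayDir i + ⟪rayDir (i + 1), v⟫_ℝ • rayDir (i + 1) = v := by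
  ext j
  fin_cases i <;> fin_cases j <;> simp [rayDir, PiLp.inner_apply]

theorem norm_le_abs_inner_rayDir_add (i : Fin 4) (v : Plane) :
    ‖v‖ ≤ |⟪rayDir i, v⟫_ℝ| + |⟪rayDir (i + 1), v⟫_ℝ| := by
  conv_lhs => rw [← inner_smul_rayDir_add i v]
  simpa only [norm_smul, norm_rayDir, mul_one, Real.norm_eq_abs] using
    norm_add_le (⟪rayDir i, v⟫_ℝ • rayDir i) (⟪rayDir (i + 1), v⟫_ℝ • rayDir (i + 1))

theorem abs_inner_rayDir_le (i : Fin 4) (v : Plane) : |⟪rayDir i, v⟫_ℝ| ≤ ‖v‖ := by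
  simpa only [norm_rayDir, one_mul] using abs_real_inner_le_norm (rayDir i) v

theorem mem_cone_iff {i : Fin 4} {p q : Plane} :
    q ∈ cone i p ↔ 0 ≤ ⟪rayDir i, q - p⟫_ℝ ∧ 0 ≤ ⟪rayDir (i + 1), q - p⟫_ℝ := by
  constructor
  · rintro ⟨a, b, ha, hb, rfl⟩
    have hperp : ⟪rayDir (i + 1), rayDir i⟫_ℝ = 0 := by
      rw [real_inner_comm, inner_rayDir_add_one]
    simp [inner_add_right, real_inner_smul_right, inner_rayDir_add_one, hperp, norm_rayDir, ha, hb]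
  · rintro ⟨ha, hb⟩
    exact ⟨_, _, ha, hb, by rw [inner_smul_rayDir_add, add_sub_cancel]⟩

theorem dist_le_of_mem_cone {i : Fin 4} {p q : Plane} (h : q ∈ cone i p) :
    dist p q ≤ ⟪rayDir i, q - p⟫_ℝ + ⟪rayDir (i + 1), q - p⟫_ℝ := by
  obtain ⟨ha, hb⟩ := mem_cone_iff.mp h
  rw [dist_comm, dist_eq_norm]
  simpa only [abs_of_nonneg ha, abs_of_nonneg hb] using norm_le_abs_inner_rayDir_add i (q - p)

theorem norm_bisectorDir (i : Fin 4) : ‖bisectorDir i‖ = 1 := by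
  have hsq : ‖rayDir i + rayDir (i + 1)‖ ^ 2 = 2 := by
    rw [norm_add_sq_real, norm_rayDir, norm_rayDir, inner_rayDir_add_one]
    norm_num
  rw [bisectorDir, norm_smul, ← Real.sqrt_sq (norm_nonneg (rayDir i + rayDir (i + 1))), hsq,
    Real.norm_of_nonneg (by positivity), inv_mul_cancel₀ (by positivity)]

theorem dist_bisectorProj {i : Fin 4} {p q : Plane} (h : q ∈ cone i p) :
    dist p (bisectorProj i p q) =
      (√2)⁻¹ * (⟪rayDir i, q - p⟫_ℝ + ⟪rayDir (i + 1), q - p⟫_ℝ) := by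
  obtain ⟨ha, hb⟩ := mem_cone_iff.mp h
  have hinner : ⟪bisectorDir i, q - p⟫_ℝ =
      (√2)⁻¹ * (⟪rayDir i, q - p⟫_ℝ + ⟪rayDir (i + 1), q - p⟫_ℝ) := by
    rw [bisectorDir, real_inner_smul_left, inner_add_left]
  rw [bisectorProj, dist_self_add_right, norm_smul, norm_bisectorDir, mul_one, hinner,
    Real.norm_of_nonneg (by positivity)]

variable {P : Finset Plane} {p q : Plane}

theorem GeneralPosition.inner_rayDir_ne_zero (hgp : GeneralPosition P) (hp : p ∈ P) (hq : q ∈ P)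
    (hne : p ≠ q) (i : Fin 4) : ⟪rayDir i, q - p⟫_ℝ ≠ 0 := by
  intro h
  refine (hgp p hp q hq hne (i + 1)).1 (Submodule.mem_span_singleton.mpr
    ⟨⟪rayDir (i + 1), q - p⟫_ℝ, ?_⟩)
  simpa [h] using inner_smul_rayDir_add i (q - p)

theorem GeneralPosition.inner_rayDir_ne_add_one (hgp : GeneralPosition P) (hp : p ∈ P)
    (hq : q ∈ P) (hne : p ≠ q) (i : Fin 4) :
    ⟪rayDir i, q - p⟫_ℝ ≠ ⟪rayDir (i + 1), q - p⟫_ℝ := by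
  intro h
  refine (hgp p hp q hq hne i).2 (Submodule.mem_span_singleton.mpr
    ⟨⟪rayDir i, q - p⟫_ℝ * √2, ?_⟩)
  have hdecomp := inner_smul_rayDir_add i (q - p)
  rwa [← h, ← smul_add, ← mul_inv_cancel_right₀ (b := √2) (by positivity) ⟪rayDir i, q - p⟫_ℝ,
    mul_smul] at hdecomp

theorem GeneralPosition.abs_inner_rayDir_ne_add_one (hgp : GeneralPosition P) (hp : p ∈ P)
    (hq : q ∈ P) (hne : p ≠ q) (i : Fin 4) :
    |⟪rayDir i, q - p⟫_ℝ| ≠ |⟪rayDir (i + 1), q - p⟫_ℝ| := by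
  intro h
  rcases abs_eq_abs.mp h with h | h
  · exact hgp.inner_rayDir_ne_add_one hp hq hne i h
  · refine hgp.inner_rayDir_ne_add_one hp hq hne (i + 1) ?_
    rw [add_assoc, show (1 : Fin 4) + 1 = 2 from rfl, rayDir_add_two, inner_neg_left, h, neg_neg]

theorem GeneralPosition.exists_isConeNeighbor (hgp : GeneralPosition P) {i : Fin 4} (hq : q ∈ P)
    (hqc : q ∈ cone i p) (hqp : q ≠ p) : ∃ n, IsConeNeighbor P i p n := by
  classical
  obtain ⟨n, hn, hmin⟩ := (P.filter fun x => x ∈ cone i p ∧ x ≠ p).exists_min_image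
    (fun x => dist p (bisectorProj i p x)) ⟨q, Finset.mem_filter.mpr ⟨hq, hqc, hqp⟩⟩
  obtain ⟨hnP, hnc, hnp⟩ := Finset.mem_filter.mp hn
  refine ⟨n, hnP, hnc, hnp, fun x hx hxc hxp hxn => ?_⟩
  refine (hmin x (Finset.mem_filter.mpr ⟨hx, hxc, hxp⟩)).lt_of_ne fun htie => ?_
  rw [dist_bisectorProj hnc, dist_bisectorProj hxc, mul_right_inj' (by positivity)] at htie
  refine hgp.abs_inner_rayDir_ne_add_one hnP hx hxn.symm i (abs_eq_abs.mpr (.inr ?_))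
  rw [← sub_sub_sub_cancel_right x n p, inner_sub_right, inner_sub_right (rayDir (i + 1))]
  linarith

theorem theta4Graph_adj_of_isConeNeighbor {p n : P} {i : Fin 4}
    (h : IsConeNeighbor P i p n) : (theta4Graph P).Adj p n :=
  (SimpleGraph.fromRel_adj _ _ _).mpr ⟨fun hpn => h.2.2.1 (by rw [hpn]), .inl ⟨i, h⟩⟩

/-- The coordinate along the ray `i` of a vertex, relative to the origin `t`. -/
noncomputable def rayCoord (i : Fin 4) (t : Plane) (p : P) : ℝ := ⟪rayDir i, (p : Plane) - t⟫_ℝ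

theorem rayCoord_sub_rayCoord (i : Fin 4) (t : Plane) (x y : P) :
    rayCoord i t x - rayCoord i t y = ⟪rayDir i, (x : Plane) - y⟫_ℝ := by
  rw [rayCoord, rayCoord, ← inner_sub_right, sub_sub_sub_cancel_right]

theorem rayCoord_add_two (i : Fin 4) (t : Plane) :
    rayCoord (P := P) (i + 2) t = -rayCoord i t := by
  ext p
  rw [rayCoord, rayDir_add_two, inner_neg_left, Pi.neg_apply, rayCoord]

theorem rayCoord_self (i : Fin 4) (t : P) : rayCoord i t t = 0 := by
  rw [rayCoord, sub_self, inner_zero_right]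

theorem mem_cone_iff_rayCoord {i : Fin 4} {t : Plane} {p q : P} :
    (q : Plane) ∈ cone i p ↔
      rayCoord i t p ≤ rayCoord i t q ∧ rayCoord (i + 1) t p ≤ rayCoord (i + 1) t q := by
  rw [mem_cone_iff, ← rayCoord_sub_rayCoord i t, ← rayCoord_sub_rayCoord (i + 1) t, sub_nonneg,
    sub_nonneg]

theorem IsConeNeighbor.rayCoord_add_le {i : Fin 4} {t : Plane} {p n x : P}
    (hn : IsConeNeighbor P i p n) (hx : (x : Plane) ∈ cone i p) (hxp : x ≠ p) :
    rayCoord i t n + rayCoord (i + 1) t n ≤ rayCoord i t x + rayCoord (i + 1) t x := by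
  rcases eq_or_ne x n with rfl | hxn
  · exact le_rfl
  obtain ⟨-, hnc, -, hmin⟩ := hn
  have hlt := hmin x x.2 hx (Subtype.coe_ne_coe.mpr hxp) (Subtype.coe_ne_coe.mpr hxn)
  rw [dist_bisectorProj hnc, dist_bisectorProj hx, mul_lt_mul_iff_right₀ (by positivity)] at hlt
  linarith [rayCoord_sub_rayCoord i t n p, rayCoord_sub_rayCoord (i + 1) t n p,
    rayCoord_sub_rayCoord i t x p, rayCoord_sub_rayCoord (i + 1) t x p]

theorem GeneralPosition.rayCoord_injective (hgp : GeneralPosition P) (i : Fin 4) (t : Plane) :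
    Function.Injective (rayCoord (P := P) i t) := by
  intro p q hpq
  by_contra hne
  refine hgp.inner_rayDir_ne_zero p.2 q.2 (Subtype.coe_ne_coe.mpr hne) i ?_
  rw [← rayCoord_sub_rayCoord i t, hpq, sub_self]

theorem GeneralPosition.quadrantStep_theta4Graph (hgp : GeneralPosition P) (i : Fin 4)
    (t : Plane) : QuadrantStep (euclideanWeight P) (theta4Graph P)
      (rayCoord i t) (rayCoord (i + 1) t) := by
  intro p q hA hB
  have hqc : (q : Plane) ∈ cone i p := mem_cone_iff_rayCoord.mpr ⟨hA.le, hB.le⟩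
  have hqp : (q : Plane) ≠ p := Subtype.coe_ne_coe.mpr (ne_of_apply_ne _ hA.ne')
  obtain ⟨n, hn⟩ := hgp.exists_isConeNeighbor q.2 hqc hqp
  lift n to P using hn.1
  have ⟨_, hnc, hnp, _⟩ := hn
  have hpn : p ≠ n := (Subtype.coe_ne_coe.mp hnp).symm
  obtain ⟨hnA, hnB⟩ := mem_cone_iff_rayCoord (t := t).mp hnc
  refine ⟨n, hnA.lt_of_ne ((hgp.rayCoord_injective i t).ne hpn),
    hnB.lt_of_ne ((hgp.rayCoord_injective (i + 1) t).ne hpn), fun x hxA hxB => ?_, ?_⟩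
  · exact hn.rayCoord_add_le (mem_cone_iff_rayCoord.mpr ⟨hxA.le, hxB.le⟩)
      (ne_of_apply_ne _ hxA.ne')
  · rw [rayCoord_sub_rayCoord, rayCoord_sub_rayCoord]
    exact (ReachesWithin.of_adj (theta4Graph_adj_of_isConeNeighbor hn)).mono
      (dist_le_of_mem_cone hnc)

theorem GeneralPosition.isFrame_theta4Graph (hgp : GeneralPosition P) (t : P) :
    IsFrame (euclideanWeight P) (theta4Graph P) t (rayCoord 1 t) (rayCoord 2 t) where
  step_pos_pos := hgp.quadrantStep_theta4Graph 1 t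
  step_neg_pos := rayCoord_add_two 1 (t : Plane) ▸ (hgp.quadrantStep_theta4Graph 2 t).swap
  step_pos_neg := rayCoord_add_two 2 (t : Plane) ▸ (hgp.quadrantStep_theta4Graph 0 t).swap
  step_neg_neg := by
    rw [← rayCoord_add_two, ← rayCoord_add_two]
    exact hgp.quadrantStep_theta4Graph 3 t
  fst_target := rayCoord_self 1 t
  snd_target := rayCoord_self 2 t
  fst_injective := hgp.rayCoord_injective 1 t
  snd_injective := hgp.rayCoord_injective 2 t
  abs_fst_ne_abs_snd p hp :=
    hgp.abs_inner_rayDir_ne_add_one t.2 p.2 (Subtype.coe_ne_coe.mpr hp.symm) 1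

theorem GeneralPosition.reachesWithin_theta4Graph (hgp : GeneralPosition P) (u v : P) :
    ReachesWithin (euclideanWeight P) (theta4Graph P) u v (21 * euclideanWeight P u v) := by
  refine ((hgp.isFrame_theta4Graph v).reachesWithin_supNorm u).mono ?_
  rw [euclideanWeight, coe_nndist, dist_eq_norm]
  gcongr
  exact max_le (abs_inner_rayDir_le 1 _) (abs_inner_rayDir_le 2 _)

end Cones

theorem mainTheorem1_general (P : Finset Plane) (hP : P.Nonempty) (hgp : GeneralPosition P) :
    IsSpanner (euclideanWeight P) ⊤ (theta4Graph P) 21 ∧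
      ∃ τ : ℝ, IsStretchFactor (euclideanWeight P) ⊤ (theta4Graph P) τ ∧ τ ≤ 21 := by
  have : Nonempty P := hP.to_subtype
  have hspanner : IsSpanner (euclideanWeight P) ⊤ (theta4Graph P) 21 :=
    .of_reachesWithin (fun _ => nndist_self _) (fun _ _ _ => nndist_triangle _ _ _) (by norm_num)
      hgp.reachesWithin_theta4Graph
  exact ⟨hspanner, hspanner.exists_isStretchFactor SimpleGraph.connected_top⟩

theorem stretch_constant_bounds : 21 ≤ (1 + √2) * (√2 + 36) * √(4 + 2 * √2) ∧
    (1 + √2) * (√2 + 36) * √(4 + 2 * √2) < 237 := by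
  have hprod : (1 + √2) * (√2 + 36) = 38 + 37 * √2 := by
    linear_combination Real.mul_self_sqrt (show (0 : ℝ) ≤ 2 by norm_num)
  have hlt : √2 < 1.4143 := (Real.sqrt_lt' (by norm_num)).mpr (by norm_num)
  have hlt' : √(4 + 2 * √2) < 2.614 := (Real.sqrt_lt' (by norm_num)).mpr (by linarith)
  have hle' : 1 ≤ √(4 + 2 * √2) := Real.one_le_sqrt.mpr (by linarith [Real.sqrt_nonneg 2])
  rw [hprod]
  constructor
  · nlinarith [Real.sqrt_nonneg 2]
  · calc (38 + 37 * √2) * √(4 + 2 * √2) ≤ (38 + 37 * 1.4143) * 2.614 := by gcongr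
      _ < 237 := by norm_num

theorem mainTheorem1 (P : Finset Plane) (hP : P.Nonempty) (hgp : GeneralPosition P) :
    IsSpanner (euclideanWeight P) ⊤ (theta4Graph P)
        ((1 + √2) * (√2 + 36) * √(4 + 2 * √2)) ∧
      (∃ τ : ℝ, IsStretchFactor (euclideanWeight P) ⊤ (theta4Graph P) τ ∧
        τ ≤ (1 + √2) * (√2 + 36) * √(4 + 2 * √2)) ∧
      (1 + √2) * (√2 + 36) * √(4 + 2 * √2) < 237 := by
  obtain ⟨hspanner, τ, hτ, hle⟩ := mainTheorem1_general P hP hgp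
  obtain ⟨hlower, hupper⟩ := stretch_constant_bounds
  exact ⟨hspanner.mono hlower, ⟨τ, hτ, hle.trans hlower⟩, hupper⟩
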